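/- Let $(\Omega,\Sigma,\mu)$ be a complete, $\sigma$-finite, non-atomic measure space, let $\mathbb{K}$ be $\mathbb{R}$ or $\mathbb{C}$, and let $L_0=L_0(\mu)$ be the space of all classes, modulo equality almost everywhere, of $\mathbb{K}$-valued measurable functions on $\Omega$ that are integrable on every measurable set of finite measure. A Köthe function space over $(\Omega,\Sigma,\mu)$ is a linear subspace $X\subseteq L_0$ with a complete norm such that (i) if $f$ is measurable, $g\in X$ and $|f|\le|g|$ almost everywhere, then $f\in X$ and $\|f\|_X\le\|g\|_X$; and (ii) $\chi_\sigma\in X$ for every $\sigma\in\Sigma$ with $\mu(\sigma)<\infty$. It has the Fatou property if its closed unit ball is closed in $L_0$ for the topology of local convergence in measure (convergence in measure on every set of finite measure). It is order continuous if, for every $f\in X$ and every sequence $(f_n)$ in $X$ with $0\le f_n\le|f|$ and $f_n\downarrow0$ almost everywhere, one has $\|f_n\|_X\to0$. For Köthe function spaces $X,Y$ over $(\Omega,\Sigma,\mu)$ put $$M(X,Y)=\{\lambda\in L_0:\ \lambda f\in Y\text{ for all }f\in X\},\qquad \|\lambda\|_{M(X,Y)}=\sup_{\|f\|_X\le1}\|\lambda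 f\|_Y .$$ For $\lambda\in M(X,Y)$ let $M_\lambda\colon X\to Y$, $f\mapsto\lambda f$, be the multiplication operator (it is automatically bounded). For a bounded linear operator $T\colon X\to Y$ let $$\|T\|_{ess}=\inf\{\|T-K\|_{X\to Y}:\ K\colon X\to Y\text{ a compact linear operator}\}.$$ **Theorem.** Let $X$ and $Y$ be Köthe function spaces with the Fatou property over the same complete, $\sigma$-finite, non-atomic measure space $(\Omega,\Sigma,\mu)$, and suppose that either $X$ is order continuous or $Y$ is reflexive. Then for every $\lambda\in M(X,Y)$ $$\|M_\lambda\colon X\to Y\|_{ess}=\|M_\lambda\colon X\to Y\|=\|\lambda\|_{M(X,Y)} .$$ In particular, there are no non-trivial compact multiplication operators from $X$ to $Y$: if $\lambda\in M(X,Y)$ and $M_\lambda\colon X\to Y$ is compact, then $\lambda=0$. -/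

import Mathlib

open MeasureTheory Filter Topology
open scoped ComplexOrder ENNReal

noncomputable section

/-- A measure is non-atomic if every measurable set of positive measure has a measurable subset of
strictly smaller positive measure.  (For `σ`-finite measures this says exactly that there are no
atoms; it is stronger than the condition that singletons are null.) -/
def IsNonatomic {Ω : Type*} [MeasurableSpace Ω] (μ : Measure Ω) : Prop :=
  ∀ A : Set Ω, MeasurableSet A → 0 < μ A → ∃ B ⊆ A, MeasurableSet B ∧ 0 < μ B ∧ μ B < μ A

/-- `L₀(μ)`: classes, modulo equality almost everywhere, of `𝕜`-valued measurable functions that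
are integrable on every measurable set of finite measure. -/
def L0 (𝕜 : Type*) [RCLike 𝕜] {Ω : Type*} [MeasurableSpace Ω] (μ : Measure Ω) :
    Submodule 𝕜 (Ω →ₘ[μ] 𝕜) where
  carrier := {f | ∀ σ : Set Ω, MeasurableSet σ → μ σ < ∞ → IntegrableOn (f : Ω → 𝕜) σ μ}
  add_mem' := by
    intro f g hf hg σ hσ hμ
    exact ((hf σ hσ hμ).add (hg σ hσ hμ)).congr
      (ae_restrict_of_ae (AEEqFun.coeFn_add f g).symm)
  zero_mem' := by
    intro σ _ _
    exact (integrable_zero Ω 𝕜 (μ.restrict σ)).congr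
      (ae_restrict_of_ae (AEEqFun.coeFn_zero (μ := μ) (β := 𝕜)).symm)
  smul_mem' := by
    intro c f hf σ hσ hμ
    exact ((hf σ hσ hμ).smul c).congr (ae_restrict_of_ae (AEEqFun.coeFn_smul c f).symm)

/-- A Köthe space (Banach ideal space, Banach function space) over `(Ω, μ)`: a linear subspace of
`L₀(μ)` with a complete norm, which is solid (the ideal property) and contains the characteristic
functions of all measurable sets of finite measure. -/
structure KotheSpace (𝕜 : Type*) [RCLike 𝕜] {Ω : Type*} [MeasurableSpace Ω] (μ : Measure Ω) where
  /-- the underlying space of (classes of) functions -/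
  toSubmodule : Submodule 𝕜 (Ω →ₘ[μ] 𝕜)
  /-- the norm -/
  nrm : Seminorm 𝕜 toSubmodule
  eq_zero_of_nrm_eq_zero : ∀ f : toSubmodule, nrm f = 0 → f = 0
  /-- every Cauchy sequence converges -/
  complete : ∀ u : ℕ → toSubmodule,
    (∀ ε : ℝ, 0 < ε → ∃ N : ℕ, ∀ m ≥ N, ∀ n ≥ N, nrm (u m - u n) < ε) →
    ∃ f : toSubmodule, Tendsto (fun n => nrm (u n - f)) atTop (𝓝 0)
  le_L0 : toSubmodule ≤ L0 𝕜 μ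
  solid : ∀ (f : Ω →ₘ[μ] 𝕜) (g : toSubmodule),
    (∀ᵐ ω ∂μ, ‖f ω‖ ≤ ‖(g : Ω →ₘ[μ] 𝕜) ω‖) → ∃ hf : f ∈ toSubmodule, nrm ⟨f, hf⟩ ≤ nrm g
  indicator_mem : ∀ (σ : Set Ω) (hσ : MeasurableSet σ), μ σ < ∞ →
    AEEqFun.mk (σ.indicator fun _ => (1 : 𝕜))
      (aestronglyMeasurable_const.indicator hσ) ∈ toSubmodule

namespace KotheSpace

section Basic

variable {𝕜 : Type*} [RCLike 𝕜] {Ω : Type*} [MeasurableSpace Ω] {μ : Measure Ω}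

instance : CoeSort (KotheSpace 𝕜 μ) (Type _) := ⟨fun X => X.toSubmodule⟩

instance instNorm (X : KotheSpace 𝕜 μ) : Norm X := ⟨fun f => X.nrm f⟩

theorem core (X : KotheSpace 𝕜 μ) : NormedSpace.Core 𝕜 X where
  norm_nonneg f := apply_nonneg X.nrm f
  norm_smul c f := map_smul_eq_mul X.nrm c f
  norm_triangle f g := map_add_le_add X.nrm f g
  norm_eq_zero_iff f := ⟨X.eq_zero_of_nrm_eq_zero f, fun h => by rw [h]; exact map_zero X.nrm⟩

instance instNormedAddCommGroup (X : KotheSpace 𝕜 μ) : NormedAddCommGroup X :=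
  NormedAddCommGroup.ofCore X.core

instance instNormedSpace (X : KotheSpace 𝕜 μ) : NormedSpace 𝕜 X :=
  NormedSpace.ofCore X.core

instance instCompleteSpace (X : KotheSpace 𝕜 μ) : CompleteSpace X := by
  refine Metric.complete_of_cauchySeq_tendsto fun u hu => ?_
  obtain ⟨f, hf⟩ := X.complete u (by
    intro ε hε
    obtain ⟨N, hN⟩ := Metric.cauchySeq_iff.1 hu ε hε
    refine ⟨N, fun m hm n hn => ?_⟩
    have := hN m hm n hn
    rwa [dist_eq_norm] at this)
  exact ⟨f, tendsto_iff_norm_sub_tendsto_zero.2 hf⟩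

/-- `X` is order continuous: for all `f ∈ X` and every sequence `0 ≤ uₙ ≤ |f|` in `X` that
decreases to `0` pointwise (almost everywhere), the norms `‖uₙ‖` tend to `0`. -/
def OrderContinuous (X : KotheSpace 𝕜 μ) : Prop :=
  ∀ (f : X) (u : ℕ → X),
    (∀ n, ∀ᵐ ω ∂μ, 0 ≤ (u n : Ω →ₘ[μ] 𝕜) ω ∧
      ‖(u n : Ω →ₘ[μ] 𝕜) ω‖ ≤ ‖(f : Ω →ₘ[μ] 𝕜) ω‖) →
    (∀ᵐ ω ∂μ, Antitone (fun n => (u n : Ω →ₘ[μ] 𝕜) ω) ∧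
      Tendsto (fun n => (u n : Ω →ₘ[μ] 𝕜) ω) atTop (𝓝 0)) →
    Tendsto (fun n => ‖u n‖) atTop (𝓝 0)

/-- `X` has the Fatou property: the closed unit ball of `X` is closed in `L₀(μ)` for the topology of
local convergence in measure.  A neighbourhood base of `f` in that topology is given by the sets
`{g | μ {ω ∈ σ | ε ≤ |g ω - f ω|} ≤ ε}`, where `μ σ < ∞` and `ε > 0`. -/
def Fatou (X : KotheSpace 𝕜 μ) : Prop :=
  ∀ f ∈ L0 𝕜 μ,
    (∀ σ : Set Ω, MeasurableSet σ → μ σ < ∞ → ∀ ε : ℝ, 0 < ε →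
      ∃ g : X, ‖g‖ ≤ 1 ∧
        μ {ω ∈ σ | ε ≤ ‖(g : Ω →ₘ[μ] 𝕜) ω - f ω‖} ≤ ENNReal.ofReal ε) →
    ∃ hf : f ∈ X.toSubmodule, ‖(⟨f, hf⟩ : X)‖ ≤ 1

/-- The space `M(X, Y)` of pointwise multipliers from `X` to `Y`. -/
def multipliers (X Y : KotheSpace 𝕜 μ) : Submodule 𝕜 (Ω →ₘ[μ] 𝕜) where
  carrier := {g | g ∈ L0 𝕜 μ ∧ ∀ f : X, g * (f : Ω →ₘ[μ] 𝕜) ∈ Y.toSubmodule}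
  add_mem' := by
    rintro a b ⟨ha, ha'⟩ ⟨hb, hb'⟩
    refine ⟨add_mem ha hb, fun f => ?_⟩
    have : (a + b) * (f : Ω →ₘ[μ] 𝕜) = a * f + b * f := by
      apply AEEqFun.ext
      filter_upwards [AEEqFun.coeFn_mul (a + b) (f : Ω →ₘ[μ] 𝕜), AEEqFun.coeFn_add a b,
        AEEqFun.coeFn_add (a * (f : Ω →ₘ[μ] 𝕜)) (b * f), AEEqFun.coeFn_mul a (f : Ω →ₘ[μ] 𝕜),
        AEEqFun.coeFn_mul b (f : Ω →ₘ[μ] 𝕜)] with ω h1 h2 h3 h4 h5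
      simp [h1, h2, h3, h4, h5, add_mul]
    rw [this]
    exact add_mem (ha' f) (hb' f)
  zero_mem' := by
    refine ⟨zero_mem _, fun f => ?_⟩
    have : (0 : Ω →ₘ[μ] 𝕜) * (f : Ω →ₘ[μ] 𝕜) = 0 := by
      apply AEEqFun.ext
      filter_upwards [AEEqFun.coeFn_mul (0 : Ω →ₘ[μ] 𝕜) (f : Ω →ₘ[μ] 𝕜),
        AEEqFun.coeFn_zero (μ := μ) (β := 𝕜)] with ω h1 h2
      simp [h1, h2]
    rw [this]
    exact zero_mem _
  smul_mem' := by
    rintro c a ⟨ha, ha'⟩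
    refine ⟨Submodule.smul_mem _ c ha, fun f => ?_⟩
    have : (c • a) * (f : Ω →ₘ[μ] 𝕜) = c • (a * (f : Ω →ₘ[μ] 𝕜)) := by
      apply AEEqFun.ext
      filter_upwards [AEEqFun.coeFn_mul (c • a) (f : Ω →ₘ[μ] 𝕜), AEEqFun.coeFn_smul c a,
        AEEqFun.coeFn_smul c (a * (f : Ω →ₘ[μ] 𝕜)),
        AEEqFun.coeFn_mul a (f : Ω →ₘ[μ] 𝕜)] with ω h1 h2 h3 h4
      simp [h1, h2, h3, h4, mul_assoc]
    rw [this]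
    exact Submodule.smul_mem _ c (ha' f)

/-- The multiplication operator `f ↦ l f` from `X` to `Y`, as a linear map. -/
def mulLin (X Y : KotheSpace 𝕜 μ) (l : multipliers X Y) : X →ₗ[𝕜] Y where
  toFun f := ⟨(l : Ω →ₘ[μ] 𝕜) * (f : Ω →ₘ[μ] 𝕜), l.2.2 f⟩
  map_add' f g := by
    apply Subtype.ext
    apply AEEqFun.ext
    filter_upwards [AEEqFun.coeFn_mul (l : Ω →ₘ[μ] 𝕜) ((f + g : X) : Ω →ₘ[μ] 𝕜),
      AEEqFun.coeFn_add (f : Ω →ₘ[μ] 𝕜) (g : Ω →ₘ[μ] 𝕜),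
      AEEqFun.coeFn_mul (l : Ω →ₘ[μ] 𝕜) (f : Ω →ₘ[μ] 𝕜),
      AEEqFun.coeFn_mul (l : Ω →ₘ[μ] 𝕜) (g : Ω →ₘ[μ] 𝕜),
      AEEqFun.coeFn_add ((l : Ω →ₘ[μ] 𝕜) * (f : Ω →ₘ[μ] 𝕜)) ((l : Ω →ₘ[μ] 𝕜) * (g : Ω →ₘ[μ] 𝕜))]
      with ω h1 h2 h3 h4 h5
    simp_all [mul_add]
  map_smul' c f := by
    apply Subtype.ext
    apply AEEqFun.ext
    filter_upwards [AEEqFun.coeFn_mul (l : Ω →ₘ[μ] 𝕜) ((c • f : X) : Ω →ₘ[μ] 𝕜),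
      AEEqFun.coeFn_smul c (f : Ω →ₘ[μ] 𝕜),
      AEEqFun.coeFn_mul (l : Ω →ₘ[μ] 𝕜) (f : Ω →ₘ[μ] 𝕜),
      AEEqFun.coeFn_smul c ((l : Ω →ₘ[μ] 𝕜) * (f : Ω →ₘ[μ] 𝕜))] with ω h1 h2 h3 h4
    simp_all [mul_left_comm]

/-- The norm of `M(X, Y)`: the supremum of `‖l f‖` in `Y` over the closed unit ball of `X`.  The set
is bounded by `mulLin_bound` below. -/
def multiplierNorm (X Y : KotheSpace 𝕜 μ) (l : multipliers X Y) : ℝ :=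
  sSup {r : ℝ | ∃ f : X, ‖f‖ ≤ 1 ∧ r = ‖mulLin X Y l f‖}

theorem norm_le_norm (X : KotheSpace 𝕜 μ) (f g : X)
    (h : ∀ᵐ ω ∂μ, ‖(f : Ω →ₘ[μ] 𝕜) ω‖ ≤ ‖(g : Ω →ₘ[μ] 𝕜) ω‖) : ‖f‖ ≤ ‖g‖ :=
  (X.solid f g h).2

theorem exists_of_le (X : KotheSpace 𝕜 μ) (f : Ω → 𝕜) (hf : AEStronglyMeasurable f μ) (g : X)
    (h : ∀ᵐ ω ∂μ, ‖f ω‖ ≤ ‖(g : Ω →ₘ[μ] 𝕜) ω‖) :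
    ∃ k : X, (∀ᵐ ω ∂μ, (k : Ω →ₘ[μ] 𝕜) ω = f ω) ∧ ‖k‖ ≤ ‖g‖ := by
  have h0 := AEEqFun.coeFn_mk f hf
  obtain ⟨h1, h2⟩ := X.solid (AEEqFun.mk f hf) g (by
    filter_upwards [h, h0] with ω a b
    rwa [b])
  exact ⟨⟨_, h1⟩, h0, h2⟩

/-- A sum of a norm-convergent series of non-negative functions dominates each of its terms. -/
theorem le_of_hasSum (X : KotheSpace 𝕜 μ) (g : ℕ → X) (S : X) (hS : HasSum g S)
    (hg : ∀ n, ∀ᵐ ω ∂μ, 0 ≤ (g n : Ω →ₘ[μ] 𝕜) ω) (n : ℕ) :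
    ∀ᵐ ω ∂μ, ‖(g n : Ω →ₘ[μ] 𝕜) ω‖ ≤ ‖(S : Ω →ₘ[μ] 𝕜) ω‖ := by
  have hsum : ∀ N : ℕ, ∀ᵐ ω ∂μ, ((∑ i ∈ Finset.range N, g i : X) : Ω →ₘ[μ] 𝕜) ω =
      ∑ i ∈ Finset.range N, (g i : Ω →ₘ[μ] 𝕜) ω := by
    intro N
    induction N with
    | zero =>
      filter_upwards [AEEqFun.coeFn_zero (μ := μ) (β := 𝕜)] with ω h
      simpa using h
    | succ N ih =>
      filter_upwards [ih, AEEqFun.coeFn_add ((∑ i ∈ Finset.range N, g i : X) : Ω →ₘ[μ] 𝕜)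
        (g N : Ω →ₘ[μ] 𝕜)] with ω h1 h2
      rw [Finset.sum_range_succ, Finset.sum_range_succ, ← h1]
      exact h2
  set φ : Ω → ℝ := fun ω =>
    max (‖(g n : Ω →ₘ[μ] 𝕜) ω‖ - ‖(S : Ω →ₘ[μ] 𝕜) ω‖) 0 with hφ
  have hφm : AEStronglyMeasurable (fun ω => ((φ ω : ℝ) : 𝕜)) μ := by
    refine RCLike.continuous_ofReal.comp_aestronglyMeasurable ?_
    exact ((g n : Ω →ₘ[μ] 𝕜).aestronglyMeasurable.norm.sub
      (S : Ω →ₘ[μ] 𝕜).aestronglyMeasurable.norm).sup aestronglyMeasurable_const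
  have key : ∀ N > n, ∀ᵐ ω ∂μ, ‖((φ ω : ℝ) : 𝕜)‖ ≤
      ‖((∑ i ∈ Finset.range N, g i - S : X) : Ω →ₘ[μ] 𝕜) ω‖ := by
    intro N hN
    filter_upwards [hsum N, ae_all_iff.2 hg,
      AEEqFun.coeFn_sub ((∑ i ∈ Finset.range N, g i : X) : Ω →ₘ[μ] 𝕜) (S : Ω →ₘ[μ] 𝕜)]
      with ω h1 h2 h3
    have h4 : ((∑ i ∈ Finset.range N, g i - S : X) : Ω →ₘ[μ] 𝕜) ω =
        (∑ i ∈ Finset.range N, (g i : Ω →ₘ[μ] 𝕜) ω) - (S : Ω →ₘ[μ] 𝕜) ω := by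
      rw [← h1]; exact h3
    have h5 : (g n : Ω →ₘ[μ] 𝕜) ω ≤ ∑ i ∈ Finset.range N, (g i : Ω →ₘ[μ] 𝕜) ω :=
      Finset.single_le_sum (f := fun i => (g i : Ω →ₘ[μ] 𝕜) ω) (fun i _ => h2 i)
        (Finset.mem_range.2 hN)
    have h6 : ‖(g n : Ω →ₘ[μ] 𝕜) ω‖ ≤ ‖∑ i ∈ Finset.range N, (g i : Ω →ₘ[μ] 𝕜) ω‖ := by
      have h7 := (h2 n).trans h5
      rw [← RCLike.ofReal_le_ofReal (K := 𝕜), RCLike.norm_of_nonneg' (h2 n),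
        RCLike.norm_of_nonneg' h7]
      exact h5
    rw [h4, RCLike.norm_ofReal, abs_of_nonneg (le_max_right _ _)]
    refine max_le ?_ (norm_nonneg _)
    exact (sub_le_sub_right h6 _).trans (norm_sub_norm_le _ _)
  obtain ⟨k, hk, -⟩ := X.exists_of_le _ hφm _ (key (n + 1) (Nat.lt_succ_self n))
  have hk0 : k = 0 := by
    have hlim : Tendsto (fun N => ‖∑ i ∈ Finset.range N, g i - S‖) atTop (𝓝 0) :=
      tendsto_iff_norm_sub_tendsto_zero.1 hS.tendsto_sum_nat
    have : ‖k‖ ≤ 0 := by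
      refine ge_of_tendsto hlim ?_
      filter_upwards [eventually_gt_atTop n] with N hN
      refine X.norm_le_norm _ _ ?_
      filter_upwards [hk, key N hN] with ω a b
      rwa [a]
    exact norm_le_zero_iff.1 this
  filter_upwards [hk, AEEqFun.coeFn_zero (μ := μ) (β := 𝕜)] with ω a b
  rw [hk0] at a
  have h1 : ((φ ω : ℝ) : 𝕜) = 0 := by
    rw [← a]; exact b
  have h2 : φ ω = 0 := by exact_mod_cast h1
  have h3 : ‖(g n : Ω →ₘ[μ] 𝕜) ω‖ - ‖(S : Ω →ₘ[μ] 𝕜) ω‖ ≤ φ ω := le_max_left _ _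
  linarith

/-- Multiplication operators between Köthe spaces are automatically bounded. -/
theorem mulLin_bound (X Y : KotheSpace 𝕜 μ) (l : multipliers X Y) :
    ∃ C : ℝ, ∀ f : X, ‖mulLin X Y l f‖ ≤ C * ‖f‖ := by
  have hbdd : ∃ C : ℝ, ∀ f : X, ‖f‖ ≤ 1 → ‖mulLin X Y l f‖ ≤ C := by
    by_contra! hcon
    choose f hf1 hf2 using fun n : ℕ => hcon ((4 : ℝ) ^ n)
    have hex : ∀ n, ∃ k : X, (∀ᵐ ω ∂μ, (k : Ω →ₘ[μ] 𝕜) ω = ((‖(f n : Ω →ₘ[μ] 𝕜) ω‖ : ℝ) : 𝕜)) ∧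
        ‖k‖ ≤ ‖f n‖ := fun n =>
      X.exists_of_le _ (RCLike.continuous_ofReal.comp_aestronglyMeasurable
        (f n : Ω →ₘ[μ] 𝕜).aestronglyMeasurable.norm) (f n) (by simp)
    choose a ha1 ha2 using hex
    set g : ℕ → X := fun n => (((1 / 2 : ℝ) ^ n : ℝ) : 𝕜) • a n with hgdef
    have hgω : ∀ n, ∀ᵐ ω ∂μ, (g n : Ω →ₘ[μ] 𝕜) ω =
        (((1 / 2 : ℝ) ^ n * ‖(f n : Ω →ₘ[μ] 𝕜) ω‖ : ℝ) : 𝕜) := by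
      intro n
      filter_upwards [ha1 n, AEEqFun.coeFn_smul (((1 / 2 : ℝ) ^ n : ℝ) : 𝕜) (a n : Ω →ₘ[μ] 𝕜)]
        with ω h1 h2
      refine h2.trans ?_
      rw [Pi.smul_apply, h1, smul_eq_mul, ← RCLike.ofReal_mul]
    have hsummable : Summable g := by
      refine Summable.of_norm_bounded (g := fun n : ℕ => (1 / 2 : ℝ) ^ n)
        summable_geometric_two fun n => ?_
      rw [hgdef, norm_smul, RCLike.norm_ofReal, abs_of_nonneg (by positivity)]
      exact mul_le_of_le_one_right (by positivity) ((ha2 n).trans (hf1 n))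
    obtain ⟨S, hS⟩ := hsummable
    have hdom := X.le_of_hasSum g S hS (fun n => by
      filter_upwards [hgω n] with ω h
      rw [h, RCLike.ofReal_nonneg]
      positivity)
    have hle : ∀ n : ℕ, (2 : ℝ) ^ n ≤ ‖mulLin X Y l S‖ := by
      intro n
      have h1 : ‖(((1 / 2 : ℝ) ^ n : ℝ) : 𝕜) • mulLin X Y l (f n)‖ ≤ ‖mulLin X Y l S‖ := by
        refine Y.norm_le_norm _ _ ?_
        filter_upwards [hdom n, hgω n,
          AEEqFun.coeFn_smul (((1 / 2 : ℝ) ^ n : ℝ) : 𝕜) (mulLin X Y l (f n) : Ω →ₘ[μ] 𝕜),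
          AEEqFun.coeFn_mul (l : Ω →ₘ[μ] 𝕜) (f n : Ω →ₘ[μ] 𝕜),
          AEEqFun.coeFn_mul (l : Ω →ₘ[μ] 𝕜) (S : Ω →ₘ[μ] 𝕜)] with ω b1 b2 b3 b4 b5
        have c1 : (((((1 / 2 : ℝ) ^ n : ℝ) : 𝕜) • mulLin X Y l (f n) : Y) : Ω →ₘ[μ] 𝕜) ω =
            (((1 / 2 : ℝ) ^ n : ℝ) : 𝕜) * ((l : Ω →ₘ[μ] 𝕜) ω * (f n : Ω →ₘ[μ] 𝕜) ω) := by
          refine b3.trans ?_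
          rw [Pi.smul_apply, smul_eq_mul]
          congr 1
        have c2 : (mulLin X Y l S : Ω →ₘ[μ] 𝕜) ω = (l : Ω →ₘ[μ] 𝕜) ω * (S : Ω →ₘ[μ] 𝕜) ω := b5
        rw [b2, RCLike.norm_ofReal, abs_of_nonneg (by positivity)] at b1
        rw [c1, c2, norm_mul, norm_mul, norm_mul, RCLike.norm_ofReal,
          abs_of_nonneg (by positivity)]
        calc _ = ‖(l : Ω →ₘ[μ] 𝕜) ω‖ * ((1 / 2 : ℝ) ^ n * ‖(f n : Ω →ₘ[μ] 𝕜) ω‖) := by ring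
          _ ≤ _ := by gcongr
      rw [norm_smul, RCLike.norm_ofReal, abs_of_nonneg (by positivity)] at h1
      calc (2 : ℝ) ^ n = (1 / 2 : ℝ) ^ n * 4 ^ n := by rw [← mul_pow]; norm_num
        _ ≤ (1 / 2 : ℝ) ^ n * ‖mulLin X Y l (f n)‖ := by
          gcongr
          exact (hf2 n).le
        _ ≤ _ := h1
    obtain ⟨n, hn⟩ := pow_unbounded_of_one_lt ‖mulLin X Y l S‖ (one_lt_two (α := ℝ))
    exact absurd (hle n) (not_le.2 hn)
  obtain ⟨C, hC⟩ := hbdd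
  refine ⟨C, fun f => ?_⟩
  by_cases hf : f = 0
  · simp [hf]
  have hpos : 0 < ‖f‖ := norm_pos_iff.2 hf
  have h := hC (((‖f‖⁻¹ : ℝ) : 𝕜) • f) (by
    rw [norm_smul, RCLike.norm_ofReal, abs_of_nonneg (by positivity)]
    exact (inv_mul_cancel₀ hpos.ne').le)
  rw [map_smul, norm_smul, RCLike.norm_ofReal, abs_of_nonneg (by positivity)] at h
  rwa [inv_mul_le_iff₀ hpos, mul_comm] at h

/-- The multiplication operator `M_l : X → Y`, `f ↦ l f`, as a bounded operator. -/
def mulOp (X Y : KotheSpace 𝕜 μ) (l : multipliers X Y) : X →L[𝕜] Y :=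
  (mulLin X Y l).mkContinuousOfExistsBound (mulLin_bound X Y l)

end Basic

end KotheSpace

/-- A normed space is reflexive if its canonical embedding into the bidual is onto. -/
def IsReflexiveSpace (𝕜 : Type*) [RCLike 𝕜] (E : Type*) [NormedAddCommGroup E]
    [NormedSpace 𝕜 E] : Prop :=
  Function.Surjective (NormedSpace.inclusionInDoubleDual 𝕜 E)

/-- The essential norm: the distance from `T` to the compact operators. -/
def essNorm {𝕜 : Type*} [RCLike 𝕜] {E F : Type*} [NormedAddCommGroup E] [NormedSpace 𝕜 E]
    [NormedAddCommGroup F] [NormedSpace 𝕜 F] (T : E →L[𝕜] F) : ℝ :=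
  sInf {r : ℝ | ∃ K : E →L[𝕜] F, IsCompactOperator K ∧ r = ‖T - K‖}

end

noncomputable section

/-! A compact operator cannot follow rapid sign changes, whereas a multiplication operator commutes
with them. Non-atomicity supplies pairwise orthogonal signs `r n`. Let `f` be in the unit ball of
`X` and `K` compact. Along a subsequence `K (r n * f)` converges to some `y`. Since `|r n| = 1` and
`r n ^ 2 = 1`, solidity of `Y` bounds the norm of `l * f - r n * y` by that of `l * (r n * f) - y`,
which is at most `‖M_l - K‖ + ε` far along the subsequence.

Averaging preserves this bound. The averages of `r n` tend to `0` in measure because the signs are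
orthogonal in `L²` of an equivalent finite measure, so along some of these averages `l * f - r n *
y` averages to `l * f` almost everywhere. The Fatou property of `Y` then carries the bound over to
`l * f`. Thus `‖M_l‖ ≤ ‖M_l - K‖` (`norm_mulOp_le_norm_sub`). The essential norm is therefore
attained at `K = 0`, and `K = M_l` settles the compact case.

The signs come from `exists_signFun_cesaro`, and the passage to the limit is
`Fatou.norm_le_of_tendsto_ae`. -/

/-- The `±1`-valued function attached to a set. -/
def signFun {Ω : Type*} (B : Set Ω) : Ω → ℝ := fun ω => 2 * B.indicator 1 ω - 1

theorem signFun_eq_or {Ω : Type*} (B : Set Ω) (ω : Ω) : signFun B ω = 1 ∨ signFun B ω = -1 := by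
  by_cases h : ω ∈ B
  · left; simp [signFun, h]; norm_num
  · right; simp [signFun, h]

theorem signFun_mul_self {Ω : Type*} (B : Set Ω) (ω : Ω) : signFun B ω * signFun B ω = 1 := by
  rcases signFun_eq_or B ω with h | h <;> simp [h]

theorem abs_signFun {Ω : Type*} (B : Set Ω) (ω : Ω) : |signFun B ω| = 1 := by
  rcases signFun_eq_or B ω with h | h <;> simp [h]

/-! ### Non-atomic measures and pairwise independent sets -/

section Nonatomic

variable {Ω : Type*} [MeasurableSpace Ω]

/-- Non-atomicity depends only on the null sets, among `σ`-finite measures. -/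
theorem IsNonatomic.of_absolutelyContinuous {μ ν : Measure Ω} [SigmaFinite μ] [IsFiniteMeasure ν]
    (hμ : IsNonatomic μ) (hνμ : ν ≪ μ) (hμν : μ ≪ ν) : IsNonatomic ν := by
  intro A hA hA0
  have hμA : 0 < μ A := pos_iff_ne_zero.2 fun h => hA0.ne' (hνμ h)
  -- Finiteness of `μ A'` turns the strict inequality `μ B < μ A'` into positivity of `μ (A' \ B)`,
  -- a property that depends only on null sets.
  obtain ⟨A', hA', hsub, hpos, hfin⟩ := Measure.exists_subset_measure_lt_top hA hμA
  obtain ⟨B, hBA, hB, hB0, hBlt⟩ := hμ A' hA' hpos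
  refine ⟨B, hBA.trans hsub, hB, pos_iff_ne_zero.2 fun h => hB0.ne' (hμν h), ?_⟩
  have hd : 0 < ν (A' \ B) := by
    refine pos_iff_ne_zero.2 fun h => ?_
    have h1 : μ (A' \ B) = 0 := hμν h
    rw [measure_sdiff hBA hB.nullMeasurableSet (measure_ne_top_of_subset hBA hfin.ne)] at h1
    exact (tsub_pos_of_lt hBlt).ne' h1
  calc ν B < ν B + ν (A' \ B) := ENNReal.lt_add_right (measure_ne_top _ _) hd.ne'
    _ = ν A' := by rw [← measure_union Set.disjoint_sdiff_right (hA'.diff hB), Set.union_sdiff_cancel hBA]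
    _ ≤ ν A := measure_mono hsub

/-- When a set is split in two, one piece has at most half the measure; iterating makes the measure
arbitrarily small while it stays positive. -/
theorem IsNonatomic.exists_subset_measureReal_le {ν : Measure Ω} [IsFiniteMeasure ν]
    (hν : IsNonatomic ν) {A : Set Ω} (hA : MeasurableSet A) (hA0 : 0 < ν.real A) {ε : ℝ}
    (hε : 0 < ε) : ∃ B ⊆ A, MeasurableSet B ∧ 0 < ν.real B ∧ ν.real B ≤ ε := by
  have key : ∀ n : ℕ, ∃ B ⊆ A, MeasurableSet B ∧ 0 < ν.real B ∧
      ν.real B ≤ ν.real A * (1 / 2) ^ n := by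
    intro n
    induction n with
    | zero => exact ⟨A, subset_rfl, hA, hA0, by simp⟩
    | succ n ih =>
      obtain ⟨B, hBA, hB, hB0, hBle⟩ := ih
      obtain ⟨C, hCB, hC, hC0, hCB'⟩ := hν B hB (ENNReal.toReal_pos_iff.1 hB0).1
      have h1 : 0 < ν.real C := ENNReal.toReal_pos hC0.ne' (measure_ne_top _ _)
      have h2 : ν.real C < ν.real B :=
        (ENNReal.toReal_lt_toReal (measure_ne_top _ _) (measure_ne_top _ _)).2 hCB'
      have h3 : ν.real (B \ C) = ν.real B - ν.real C := measureReal_sdiff hCB hC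
      rcases le_total (ν.real C) (ν.real B / 2) with h | h
      · refine ⟨C, hCB.trans hBA, hC, h1, h.trans ?_⟩
        rw [pow_succ]; linarith
      · refine ⟨B \ C, Set.sdiff_subset.trans hBA, hB.diff hC, by linarith, ?_⟩
        rw [pow_succ]; linarith
  have hlim : Tendsto (fun n : ℕ => ν.real A * (1 / 2 : ℝ) ^ n) atTop (𝓝 0) := by
    simpa using (tendsto_pow_atTop_nhds_zero_of_lt_one (by norm_num : (0 : ℝ) ≤ 1 / 2)
      (by norm_num)).const_mul (ν.real A)
  obtain ⟨n, hn⟩ := (hlim.eventually (gt_mem_nhds hε)).exists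
  obtain ⟨B, h1, h2, h3, h4⟩ := key n
  exact ⟨B, h1, h2, h3, h4.trans hn.le⟩

/-- Sierpiński: a non-atomic finite measure takes all intermediate values. -/
theorem IsNonatomic.exists_subset_measureReal_eq {ν : Measure Ω} [IsFiniteMeasure ν]
    (hν : IsNonatomic ν) {A : Set Ω} (hA : MeasurableSet A) {c : ℝ} (hc0 : 0 ≤ c)
    (hc : c ≤ ν.real A) : ∃ B ⊆ A, MeasurableSet B ∧ ν.real B = c := by
  -- Greedy exhaustion: `G B` holds the measures of the sets that can still be added to `B`, and
  -- each step adds at least half of its supremum. If the union fell short of `c`, one fixed set of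
  -- positive measure could be added at every stage, although the increments tend to `0`.
  let S := {B : Set Ω // B ⊆ A ∧ MeasurableSet B ∧ ν.real B ≤ c}
  let G : S → Set ℝ := fun B =>
    {x | ∃ C ⊆ A \ B.1, MeasurableSet C ∧ ν.real B.1 + ν.real C ≤ c ∧ x = ν.real C}
  have hGbdd : ∀ B, BddAbove (G B) := by
    refine fun B => ⟨ν.real A, ?_⟩
    rintro x ⟨C, hC, -, -, rfl⟩
    exact measureReal_mono (hC.trans Set.sdiff_subset)
  have hstep : ∀ B : S, ∃ B' : S, B.1 ⊆ B'.1 ∧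
      ∀ x ∈ G B, x ≤ 2 * (ν.real B'.1 - ν.real B.1) := by
    intro B
    have h0 : (0 : ℝ) ∈ G B := ⟨∅, Set.empty_subset _, MeasurableSet.empty, by
      simpa using B.2.2.2, by simp⟩
    rcases (le_csSup (hGbdd B) h0).eq_or_lt with h | h
    · exact ⟨B, subset_rfl, fun x hx => by
        have := le_csSup (hGbdd B) hx
        linarith⟩
    · obtain ⟨y, ⟨C, hCsub, hC, hCle, rfl⟩, hy⟩ := exists_lt_of_lt_csSup ⟨0, h0⟩ (half_lt_self h)
      have hun : ν.real (B.1 ∪ C) = ν.real B.1 + ν.real C :=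
        measureReal_union (Set.disjoint_of_subset_right hCsub Set.disjoint_sdiff_right) hC
      refine ⟨⟨B.1 ∪ C, Set.union_subset B.2.1 (hCsub.trans Set.sdiff_subset),
        B.2.2.1.union hC, hun.trans_le hCle⟩, Set.subset_union_left, fun x hx => ?_⟩
      have := le_csSup (hGbdd B) hx
      simp only [hun]
      linarith
  choose F hF1 hF2 using hstep
  let B : ℕ → S := fun n => F^[n] ⟨∅, Set.empty_subset _, MeasurableSet.empty, by simpa using hc0⟩
  have hBs : ∀ n, B (n + 1) = F (B n) := fun n => Function.iterate_succ_apply' F n _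
  have hmono : Monotone fun n => (B n).1 := monotone_nat_of_le_succ fun n => by
    rw [hBs]; exact hF1 _
  have hlim : Tendsto (fun n => ν.real (B n).1) atTop (𝓝 (ν.real (⋃ n, (B n).1))) :=
    (ENNReal.tendsto_toReal (measure_ne_top _ _)).comp (tendsto_measure_iUnion_atTop hmono)
  have hUm : MeasurableSet (⋃ n, (B n).1) := MeasurableSet.iUnion fun n => (B n).2.2.1
  have hUA : (⋃ n, (B n).1) ⊆ A := Set.iUnion_subset fun n => (B n).2.1
  have hle : ν.real (⋃ n, (B n).1) ≤ c := le_of_tendsto' hlim fun n => (B n).2.2.2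
  refine ⟨_, hUA, hUm, hle.antisymm (not_lt.1 fun hlt => ?_)⟩
  have hd : ν.real (A \ ⋃ n, (B n).1) = ν.real A - ν.real (⋃ n, (B n).1) :=
    measureReal_sdiff hUA hUm
  obtain ⟨C, hCsub, hC, hC0, hCle⟩ := hν.exists_subset_measureReal_le (hA.diff hUm)
    (by linarith) (sub_pos.2 hlt)
  have hdiff : Tendsto (fun n => 2 * (ν.real (B (n + 1)).1 - ν.real (B n).1)) atTop (𝓝 0) := by
    simpa using (((tendsto_add_atTop_iff_nat 1).2 hlim).sub hlim).const_mul 2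
  refine hC0.not_ge (ge_of_tendsto' hdiff fun n => ?_)
  rw [hBs]
  refine hF2 _ _ ⟨C, hCsub.trans (Set.sdiff_subset_sdiff_right (Set.subset_iUnion (fun n => (B n).1) n)), hC, ?_, rfl⟩
  have := measureReal_mono (μ := ν) (Set.subset_iUnion (fun n => (B n).1) n)
  linarith

/-- Each of the countably many fibres is halved by Sierpiński's theorem. Arbitrary `T` follow
because two measures on `ℕ` that agree on singletons are equal. -/
theorem IsNonatomic.exists_halving {ν : Measure Ω} [IsFiniteMeasure ν] (hν : IsNonatomic ν)
    {p : Ω → ℕ} (hp : Measurable p) :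
    ∃ B, MeasurableSet B ∧ ∀ T : Set ℕ, ν.real (B ∩ p ⁻¹' T) = ν.real (p ⁻¹' T) / 2 := by
  have h : ∀ k : ℕ, ∃ B ⊆ p ⁻¹' {k}, MeasurableSet B ∧ ν.real B = ν.real (p ⁻¹' {k}) / 2 :=
    fun k => hν.exists_subset_measureReal_eq (hp (measurableSet_singleton k)) (by positivity)
      (half_le_self measureReal_nonneg)
  choose b hb1 hb2 hb3 using h
  have hBm : MeasurableSet (⋃ k, b k) := MeasurableSet.iUnion hb2
  refine ⟨⋃ k, b k, hBm, fun T => ?_⟩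
  have hbk : ∀ k, (⋃ i, b i) ∩ p ⁻¹' {k} = b k := by
    intro k
    ext ω
    simp only [Set.mem_inter_iff, Set.mem_iUnion, Set.mem_preimage, Set.mem_singleton_iff]
    constructor
    · rintro ⟨⟨i, hi⟩, hk⟩
      have : p ω = i := hb1 i hi
      rwa [← hk, this]
    · exact fun hω => ⟨⟨k, hω⟩, hb1 k hω⟩
  have hmeas : ((ν.restrict (⋃ k, b k)).map p) = (2⁻¹ : ℝ≥0∞) • ν.map p := by
    refine Measure.ext_of_singleton fun k => ?_
    rw [Measure.map_apply hp (measurableSet_singleton k), Measure.smul_apply,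
      Measure.map_apply hp (measurableSet_singleton k),
      Measure.restrict_apply (hp (measurableSet_singleton k)), Set.inter_comm, hbk]
    rw [← ENNReal.toReal_eq_toReal_iff' (measure_ne_top _ _)
      (by simp [ENNReal.mul_eq_top])]
    have := hb3 k
    simp only [measureReal_def] at this
    rw [this, smul_eq_mul, ENNReal.toReal_mul]
    simp [div_eq_inv_mul]
  have := congrArg (fun m => (m T).toReal) hmeas
  simp only [Measure.smul_apply, Measure.map_apply hp (MeasurableSet.of_discrete (s := T)),
    Measure.restrict_apply (hp (MeasurableSet.of_discrete (s := T))), smul_eq_mul,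
    ENNReal.toReal_mul] at this
  rw [Set.inter_comm, measureReal_def, this, measureReal_def]
  simp [div_eq_inv_mul]

/-- A non-atomic finite measure admits a sequence of pairwise independent sets of half measure. -/
theorem IsNonatomic.exists_rademacher_sets {ν : Measure Ω} [IsFiniteMeasure ν]
    (hν : IsNonatomic ν) : ∃ B : ℕ → Set Ω, (∀ n, MeasurableSet (B n)) ∧
      (∀ n, ν.real (B n) = ν.real Set.univ / 2) ∧
      ∀ i n, i < n → ν.real (B n ∩ B i) = ν.real Set.univ / 4 := by
  classical
  choose H hH1 hH2 using fun p : {p : Ω → ℕ // Measurable p} => hν.exists_halving p.2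
  -- `p n` records membership in the first `n` sets as binary digits. Every earlier set is then a
  -- preimage under `p n`, so the next set halves it: parity reads the latest digit and division by
  -- `2` removes it.
  let F : {p : Ω → ℕ // Measurable p} → {p : Ω → ℕ // Measurable p} := fun p =>
    ⟨fun ω => 2 * p.1 ω + if ω ∈ H p then 1 else 0,
      (p.2.const_mul 2).add (Measurable.ite (hH1 p) measurable_const measurable_const)⟩
  let p : ℕ → {p : Ω → ℕ // Measurable p} := fun n => F^[n] ⟨fun _ => 0, measurable_const⟩
  have hps : ∀ n, p (n + 1) = F (p n) := fun n => Function.iterate_succ_apply' F n _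
  have hhalf : ∀ n, ν.real (H (p n)) = ν.real Set.univ / 2 := fun n => by
    simpa using hH2 (p n) Set.univ
  have hdet : ∀ i n, i < n → ∃ T : Set ℕ, H (p i) = (p n).1 ⁻¹' T := by
    intro i n hin
    induction n, hin using Nat.le_induction with
    | base =>
      refine ⟨{k | k % 2 = 1}, ?_⟩
      ext ω
      rw [hps]
      by_cases h : ω ∈ H (p i) <;> simp [F, h, Nat.add_mod]
    | succ n _ ih =>
      obtain ⟨T, hT⟩ := ih
      refine ⟨{k | k / 2 ∈ T}, ?_⟩
      rw [hT, hps]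
      ext ω
      have : (F (p n)).1 ω / 2 = (p n).1 ω := by
        simp only [F]
        split_ifs <;> omega
      simp only [Set.mem_preimage, Set.mem_ofPred_eq, this]
  refine ⟨fun n => H (p n), fun n => hH1 _, hhalf, fun i n hin => ?_⟩
  obtain ⟨T, hT⟩ := hdet i n hin
  change ν.real (H (p n) ∩ H (p i)) = _
  rw [hT, hH2, ← hT, hhalf]
  ring

/-! ### Orthogonality of sign functions and their Cesàro means -/

theorem measurable_signFun {B : Set Ω} (hB : MeasurableSet B) : Measurable (signFun B) :=
  ((measurable_one.indicator hB).const_mul 2).sub_const 1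

theorem integrable_signFun_mul {ν : Measure Ω} [IsFiniteMeasure ν] {B C : Set Ω}
    (hB : MeasurableSet B) (hC : MeasurableSet C) :
    Integrable (fun ω => signFun B ω * signFun C ω) ν :=
  Integrable.of_bound ((measurable_signFun hB).mul (measurable_signFun hC)).aestronglyMeasurable 1
    (by simp [abs_signFun])

/-- For two sets of half measure meeting in a quarter of the total, the right-hand side vanishes. -/
theorem integral_signFun_mul {ν : Measure Ω} [IsFiniteMeasure ν] {B C : Set Ω}
    (hB : MeasurableSet B) (hC : MeasurableSet C) :
    ∫ ω, signFun B ω * signFun C ω ∂ν =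
      4 * ν.real (B ∩ C) - 2 * ν.real B - 2 * ν.real C + ν.real Set.univ := by
  have hi : ∀ {D : Set Ω}, MeasurableSet D → Integrable (D.indicator (1 : Ω → ℝ)) ν :=
    fun hD => (integrable_const (1 : ℝ)).indicator hD
  have h : ∀ ω, signFun B ω * signFun C ω = 4 * (B ∩ C).indicator (1 : Ω → ℝ) ω -
      2 * B.indicator 1 ω - 2 * C.indicator 1 ω + 1 := by
    intro ω
    by_cases h1 : ω ∈ B <;> by_cases h2 : ω ∈ C <;> simp [signFun, h1, h2] <;> norm_num
  simp_rw [h]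
  have hBC := hB.inter hC
  have h1 : Integrable (fun ω => 4 * (B ∩ C).indicator (1 : Ω → ℝ) ω) ν := (hi hBC).const_mul 4
  have h2 : Integrable (fun ω => 2 * B.indicator (1 : Ω → ℝ) ω) ν := (hi hB).const_mul 2
  have h3 : Integrable (fun ω => 2 * C.indicator (1 : Ω → ℝ) ω) ν := (hi hC).const_mul 2
  have h4 : Integrable (fun ω => 4 * (B ∩ C).indicator (1 : Ω → ℝ) ω - 2 * B.indicator 1 ω) ν :=
    h1.sub h2
  have h5 : Integrable (fun ω => 4 * (B ∩ C).indicator (1 : Ω → ℝ) ω - 2 * B.indicator 1 ω -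
    2 * C.indicator 1 ω) ν := h4.sub h3
  rw [integral_add h5 (integrable_const _), integral_sub h4 h3, integral_sub h1 h2,
    integral_const_mul, integral_const_mul, integral_const_mul,
    integral_indicator_one hBC, integral_indicator_one hB, integral_indicator_one hC]
  simp

/-- Cesàro means of a sequence of orthogonal sign functions tend to `0` in measure. -/
theorem tendstoInMeasure_cesaro_signFun {ν : Measure Ω} [IsFiniteMeasure ν] {B : ℕ → Set Ω}
    (hB : ∀ n, MeasurableSet (B n))
    (horth : ∀ i j, i ≠ j → ∫ ω, signFun (B i) ω * signFun (B j) ω ∂ν = 0) :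
    TendstoInMeasure ν
      (fun (N : ℕ) ω => (N : ℝ)⁻¹ * ∑ k ∈ Finset.range N, signFun (B k) ω) atTop 0 := by
  -- Only the diagonal terms survive, so the second moment grows linearly in `N`, and Chebyshev's
  -- inequality bounds the deviation of the mean by a multiple of `1 / N`.
  have hsq : ∀ N : ℕ, ∫ ω, (∑ k ∈ Finset.range N, signFun (B k) ω) ^ 2 ∂ν =
      N * ν.real Set.univ := by
    intro N
    simp_rw [sq, Finset.sum_mul_sum]
    rw [integral_finsetSum _ fun i _ => integrable_finsetSum _ fun j _ =>
      integrable_signFun_mul (hB i) (hB j)]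
    have : ∀ i ∈ Finset.range N, ∫ ω, ∑ j ∈ Finset.range N, signFun (B i) ω * signFun (B j) ω ∂ν =
        ν.real Set.univ := by
      intro i hi
      rw [integral_finsetSum _ fun j _ => integrable_signFun_mul (hB i) (hB j),
        Finset.sum_eq_single_of_mem i hi fun j _ hj => horth i j hj.symm]
      simp [signFun_mul_self]
    rw [Finset.sum_congr rfl this]
    simp
  have hint : ∀ N : ℕ, Integrable (fun ω => (∑ k ∈ Finset.range N, signFun (B k) ω) ^ 2) ν := by
    intro N
    simp_rw [sq, Finset.sum_mul_sum]
    exact integrable_finsetSum _ fun i _ => integrable_finsetSum _ fun j _ =>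
      integrable_signFun_mul (hB i) (hB j)
  rw [tendstoInMeasure_iff_measureReal_norm]
  intro ε hε
  have hbound : ∀ N : ℕ, 0 < N → ν.real {x | ε ≤ ‖(N : ℝ)⁻¹ * ∑ k ∈ Finset.range N,
      signFun (B k) x - (0 : Ω → ℝ) x‖} ≤ ν.real Set.univ / ε ^ 2 * (N : ℝ)⁻¹ := by
    intro N hN
    have hN' : (0 : ℝ) < N := by exact_mod_cast hN
    have hmk := mul_meas_ge_le_integral_of_nonneg (μ := ν)
      (ae_of_all _ fun ω => sq_nonneg (∑ k ∈ Finset.range N, signFun (B k) ω)) (hint N)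
      ((N * ε) ^ 2)
    rw [hsq] at hmk
    have hsub : {x | ε ≤ ‖(N : ℝ)⁻¹ * ∑ k ∈ Finset.range N,
        signFun (B k) x - (0 : Ω → ℝ) x‖} ⊆
        {x | (N * ε) ^ 2 ≤ (∑ k ∈ Finset.range N, signFun (B k) x) ^ 2} := by
      intro x hx
      simp only [Set.mem_ofPred_eq, Pi.zero_apply, sub_zero, norm_mul, norm_inv,
        Real.norm_eq_abs, abs_of_pos hN'] at hx ⊢
      rw [sq_le_sq, abs_of_pos (by positivity : 0 < N * ε)]
      rwa [le_inv_mul_iff₀ hN'] at hx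
    refine (measureReal_mono hsub).trans ?_
    rw [div_mul_eq_mul_div, le_div_iff₀ (by positivity), ← div_eq_mul_inv, le_div_iff₀ hN']
    refine le_of_mul_le_mul_left ?_ hN'
    calc _ = (N * ε) ^ 2 * ν.real {x | (N * ε) ^ 2 ≤
          (∑ k ∈ Finset.range N, signFun (B k) x) ^ 2} := by ring
      _ ≤ _ := hmk
  have hlim : Tendsto (fun N : ℕ => ν.real Set.univ / ε ^ 2 * (N : ℝ)⁻¹) atTop (𝓝 0) := by
    simpa using tendsto_inv_atTop_nhds_zero_nat.const_mul (ν.real Set.univ / ε ^ 2)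
  refine squeeze_zero' (Eventually.of_forall fun N => measureReal_nonneg) ?_ hlim
  filter_upwards [eventually_gt_atTop 0] with N hN using hbound N hN

/-- On a non-atomic `σ`-finite measure space there are measurable sets whose sign functions have
the property that the Cesàro means of each subsequence tend to `0` almost everywhere along a
further subsequence of the means. -/
theorem IsNonatomic.exists_signFun_cesaro {μ : Measure Ω} [SigmaFinite μ] (hμ : IsNonatomic μ) :
    ∃ B : ℕ → Set Ω, (∀ n, MeasurableSet (B n)) ∧ ∀ φ : ℕ → ℕ, StrictMono φ →
      ∃ ns : ℕ → ℕ, StrictMono ns ∧ ∀ᵐ ω ∂μ, Tendsto (fun m =>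
        (ns m : ℝ)⁻¹ * ∑ k ∈ Finset.range (ns m), signFun (B (φ k)) ω) atTop (𝓝 0) := by
  -- Orthogonality is arranged for a finite measure with the same null sets; almost everywhere
  -- convergence then returns to `μ`.
  have hνμ : μ.toFinite ≪ μ := toFinite_absolutelyContinuous μ
  have hμν : μ ≪ μ.toFinite := absolutelyContinuous_toFinite μ
  obtain ⟨B, hB, hhalf, hquarter⟩ :=
    (hμ.of_absolutelyContinuous hνμ hμν).exists_rademacher_sets
  have horth : ∀ i j, i ≠ j → ∫ ω, signFun (B i) ω * signFun (B j) ω ∂μ.toFinite = 0 := by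
    intro i j hij
    rw [integral_signFun_mul (hB i) (hB j), hhalf, hhalf]
    rcases hij.lt_or_gt with h | h
    · rw [Set.inter_comm, hquarter i j h]; ring
    · rw [hquarter j i h]; ring
  refine ⟨B, hB, fun φ hφ => ?_⟩
  obtain ⟨ns, hns, hae⟩ := (tendstoInMeasure_cesaro_signFun (fun n => hB (φ n))
    fun i j hij => horth _ _ (hφ.injective.ne hij)).exists_seq_tendsto_ae
  exact ⟨ns, hns, hμν.ae_le hae⟩

end Nonatomic

namespace KotheSpace

/-! ### Sign changes and almost everywhere limits in Köthe spaces -/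

section EssentialNorm

variable {𝕜 : Type*} [RCLike 𝕜] {Ω : Type*} [MeasurableSpace Ω] {μ : Measure Ω}

theorem coeFn_sum (X : KotheSpace 𝕜 μ) (g : ℕ → X) (N : ℕ) :
    ∀ᵐ ω ∂μ, ((∑ i ∈ Finset.range N, g i : X) : Ω →ₘ[μ] 𝕜) ω =
      ∑ i ∈ Finset.range N, (g i : Ω →ₘ[μ] 𝕜) ω := by
  induction N with
  | zero =>
    filter_upwards [AEEqFun.coeFn_zero (μ := μ) (β := 𝕜)] with ω h
    simpa using h
  | succ N ih =>
    filter_upwards [ih, AEEqFun.coeFn_add ((∑ i ∈ Finset.range N, g i : X) : Ω →ₘ[μ] 𝕜)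
      (g N : Ω →ₘ[μ] 𝕜)] with ω h1 h2
    rw [Finset.sum_range_succ, Finset.sum_range_succ, ← h1]
    exact h2

/-- Under the Fatou property, norm bounds pass to limits almost everywhere. -/
theorem Fatou.norm_le_of_tendsto_ae {X : KotheSpace 𝕜 μ} (hX : X.Fatou) (f : X) (g : ℕ → X)
    {C : ℝ} (hC : 0 < C) (hg : ∀ᶠ n in atTop, ‖g n‖ ≤ C)
    (hlim : ∀ᵐ ω ∂μ, Tendsto (fun n => (g n : Ω →ₘ[μ] 𝕜) ω) atTop (𝓝 ((f : Ω →ₘ[μ] 𝕜) ω))) :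
    ‖f‖ ≤ C := by
  -- The Fatou property concerns the unit ball, hence the rescaling by `C⁻¹`.
  set c : 𝕜 := ((C⁻¹ : ℝ) : 𝕜)
  have hc : ‖c‖ = C⁻¹ := by rw [RCLike.norm_ofReal, abs_of_pos (inv_pos.2 hC)]
  have hlim' : ∀ᵐ ω ∂μ, Tendsto (fun n => ((c • g n : X) : Ω →ₘ[μ] 𝕜) ω) atTop
      (𝓝 (((c • f : X) : Ω →ₘ[μ] 𝕜) ω)) := by
    filter_upwards [hlim, ae_all_iff.2 fun n => AEEqFun.coeFn_smul c (g n : Ω →ₘ[μ] 𝕜),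
      AEEqFun.coeFn_smul c (f : Ω →ₘ[μ] 𝕜)] with ω h1 h2 h3
    have h4 : ∀ n, ((c • g n : X) : Ω →ₘ[μ] 𝕜) ω = c • (g n : Ω →ₘ[μ] 𝕜) ω := h2
    have h5 : ((c • f : X) : Ω →ₘ[μ] 𝕜) ω = c • (f : Ω →ₘ[μ] 𝕜) ω := h3
    simp only [h4, h5]
    exact h1.const_smul c
  obtain ⟨hf, hle⟩ := hX ((c • f : X) : Ω →ₘ[μ] 𝕜) (X.le_L0 (c • f).2) (by
    intro σ hσ hσfin ε hε
    -- On a set of finite measure, almost everywhere convergence implies convergence in measure.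
    have : IsFiniteMeasure (μ.restrict σ) := ⟨by simpa using hσfin⟩
    have hm := tendstoInMeasure_iff_norm.1 (tendstoInMeasure_of_tendsto_ae
      (fun n => ((c • g n : X) : Ω →ₘ[μ] 𝕜).aestronglyMeasurable.restrict)
      (ae_restrict_of_ae (s := σ) hlim')) ε hε
    obtain ⟨n, hn1, hn2⟩ := ((hm.eventually
      (gt_mem_nhds (ENNReal.ofReal_pos.2 hε))).and hg).exists
    refine ⟨c • g n, ?_, ?_⟩
    · rw [norm_smul, hc]
      exact (inv_mul_le_one₀ hC).2 hn2
    · refine le_trans ?_ hn1.le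
      rw [Measure.restrict_apply' hσ, Set.inter_comm]
      rfl)
  have h1 : ‖c • f‖ ≤ 1 := hle
  rw [norm_smul, hc] at h1
  exact (inv_mul_le_one₀ hC).1 h1

theorem exists_signFun_mul (X : KotheSpace 𝕜 μ) {B : Set Ω} (hB : MeasurableSet B) (f : X) :
    ∃ k : X, (∀ᵐ ω ∂μ, (k : Ω →ₘ[μ] 𝕜) ω = (signFun B ω : 𝕜) * (f : Ω →ₘ[μ] 𝕜) ω) ∧
      ‖k‖ ≤ ‖f‖ :=
  X.exists_of_le _ ((RCLike.continuous_ofReal.comp_aestronglyMeasurable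
    (measurable_signFun hB).aestronglyMeasurable).mul (f : Ω →ₘ[μ] 𝕜).aestronglyMeasurable) f
    (ae_of_all _ fun ω => by simp [abs_signFun])

theorem coeFn_mulOp (X Y : KotheSpace 𝕜 μ) (l : multipliers X Y) (f : X) :
    ∀ᵐ ω ∂μ, (mulOp X Y l f : Ω →ₘ[μ] 𝕜) ω = (l : Ω →ₘ[μ] 𝕜) ω * (f : Ω →ₘ[μ] 𝕜) ω :=
  AEEqFun.coeFn_mul (l : Ω →ₘ[μ] 𝕜) (f : Ω →ₘ[μ] 𝕜)

theorem coeFn_sub' (X : KotheSpace 𝕜 μ) (f g : X) :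
    ∀ᵐ ω ∂μ, ((f - g : X) : Ω →ₘ[μ] 𝕜) ω = (f : Ω →ₘ[μ] 𝕜) ω - (g : Ω →ₘ[μ] 𝕜) ω :=
  AEEqFun.coeFn_sub (f : Ω →ₘ[μ] 𝕜) (g : Ω →ₘ[μ] 𝕜)

theorem coeFn_smul' (X : KotheSpace 𝕜 μ) (c : 𝕜) (f : X) :
    ∀ᵐ ω ∂μ, ((c • f : X) : Ω →ₘ[μ] 𝕜) ω = c * (f : Ω →ₘ[μ] 𝕜) ω :=
  AEEqFun.coeFn_smul c (f : Ω →ₘ[μ] 𝕜)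

/-! ### The essential norm of a multiplication operator -/

/-- Perturbing a multiplication operator by a compact operator does not decrease its norm.  The
Fatou property of the target is enough: if `r n` are orthogonal sign functions and `K (r n * f)`
tends to `y` along a subsequence, then the Cesàro means of `l * f - r n * y` along it tend to `l * f`
almost everywhere, and have norm at most `‖M_l - K‖ + ε`. -/
theorem norm_mulOp_le_norm_sub [SigmaFinite μ] (hμ : IsNonatomic μ) (X Y : KotheSpace 𝕜 μ)
    (hY : Y.Fatou) (l : multipliers X Y) (K : X →L[𝕜] Y) (hK : IsCompactOperator K) :
    ‖mulOp X Y l‖ ≤ ‖mulOp X Y l - K‖ := by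
  refine ContinuousLinearMap.opNorm_le_of_unit_norm (norm_nonneg _) fun f hf' => ?_
  have hf : ‖f‖ ≤ 1 := hf'.le
  refine le_of_forall_pos_le_add fun ε hε => ?_
  obtain ⟨B, hB, hces⟩ := hμ.exists_signFun_cesaro
  choose g hg1 hg2 using fun n => X.exists_signFun_mul (hB n) f
  obtain ⟨S, hS, hsub⟩ := hK.image_closedBall_subset_compact 1
  obtain ⟨y, -, ψ, hψ, hlim⟩ := hS.tendsto_subseq (x := fun n => K (g n)) fun n =>
    hsub ⟨g n, by simpa using (hg2 n).trans hf, rfl⟩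
  obtain ⟨k₀, hk₀⟩ := Metric.tendsto_atTop.1 hlim ε hε
  -- Discarding the first `k₀` terms makes the error at most `ε` for every `k`, so that all the
  -- averages obey the same bound.
  set φ : ℕ → ℕ := fun k => ψ (k + k₀)
  have hφ : StrictMono φ := fun a b hab => hψ (Nat.add_lt_add_right hab k₀)
  obtain ⟨ns, hns, hae⟩ := hces φ hφ
  choose z hz using fun k => (Y.exists_signFun_mul (hB (φ k)) y).imp fun _ h => h.1
  set D := ‖mulOp X Y l - K‖
  have hh : ∀ k, ‖mulOp X Y l f - z k‖ ≤ D + ε := by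
    intro k
    -- Multiplying `l * f - r * y` by the sign `r` leaves its modulus unchanged and gives `l * (r *
    -- f) - y`, as `r ^ 2 = 1`.
    have h1 : ‖mulOp X Y l f - z k‖ ≤ ‖mulOp X Y l (g (φ k)) - y‖ := by
      refine Y.norm_le_norm _ _ ?_
      filter_upwards [Y.coeFn_sub' (mulOp X Y l f) (z k),
        Y.coeFn_sub' (mulOp X Y l (g (φ k))) y, coeFn_mulOp X Y l f,
        coeFn_mulOp X Y l (g (φ k)), hz k, hg1 (φ k)] with ω a1 a2 a3 a4 a5 a6
      rw [a1, a2, a3, a4, a5, a6]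
      rcases signFun_eq_or (B (φ k)) ω with h | h <;> rw [h]
      · simp
      · rw [← norm_neg]
        refine le_of_eq (congrArg _ ?_)
        push_cast
        ring
    calc _ ≤ ‖mulOp X Y l (g (φ k)) - y‖ := h1
      _ = ‖(mulOp X Y l - K) (g (φ k)) + (K (g (φ k)) - y)‖ := by
        rw [sub_apply, sub_add_sub_cancel]
      _ ≤ ‖(mulOp X Y l - K) (g (φ k))‖ + ‖K (g (φ k)) - y‖ := norm_add_le _ _
      _ ≤ D + ε := by
        refine add_le_add ?_ ?_
        · exact (ContinuousLinearMap.le_opNorm _ _).trans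
            (mul_le_of_le_one_right (norm_nonneg _) ((hg2 _).trans hf))
        · rw [← dist_eq_norm]
          exact (hk₀ (k + k₀) (Nat.le_add_left _ _)).le
  refine hY.norm_le_of_tendsto_ae (mulOp X Y l f)
    (fun m => mulOp X Y l f - ((ns m : 𝕜)⁻¹ • ∑ k ∈ Finset.range (ns m), z k))
    (by positivity) ?_ ?_
  · filter_upwards [hns.tendsto_atTop.eventually_gt_atTop 0] with m hm
    have hm' : (ns m : 𝕜) ≠ 0 := by exact_mod_cast hm.ne'
    -- The constant `l * f` is its own average, so the expression is a mean of vectors bounded by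
    -- `hh`; `ns m > 0` keeps the mean from being empty.
    have heq : mulOp X Y l f - ((ns m : 𝕜)⁻¹ • ∑ k ∈ Finset.range (ns m), z k) =
        (ns m : 𝕜)⁻¹ • ∑ k ∈ Finset.range (ns m), (mulOp X Y l f - z k) := by
      rw [Finset.sum_sub_distrib, smul_sub, Finset.sum_const, Finset.card_range,
        ← Nat.cast_smul_eq_nsmul 𝕜, inv_smul_smul₀ hm']
    rw [heq, norm_smul, norm_inv, RCLike.norm_natCast,
      inv_mul_le_iff₀ (by exact_mod_cast hm)]
    refine (norm_sum_le_of_le _ fun k _ => hh k).trans_eq ?_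
    rw [Finset.sum_const, Finset.card_range, nsmul_eq_mul]
  · filter_upwards [hae, ae_all_iff.2 fun m => Y.coeFn_sub' (mulOp X Y l f)
      ((ns m : 𝕜)⁻¹ • ∑ k ∈ Finset.range (ns m), z k),
      ae_all_iff.2 fun m => Y.coeFn_smul' (ns m : 𝕜)⁻¹ (∑ k ∈ Finset.range (ns m), z k),
      ae_all_iff.2 fun m => Y.coeFn_sum z (ns m), ae_all_iff.2 hz] with ω b1 b2 b3 b4 b5
    have hlim' : Tendsto (fun m => (mulOp X Y l f : Ω →ₘ[μ] 𝕜) ω -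
        (((ns m : ℝ)⁻¹ * ∑ k ∈ Finset.range (ns m), signFun (B (φ k)) ω : ℝ) : 𝕜) *
          (y : Ω →ₘ[μ] 𝕜) ω) atTop (𝓝 ((mulOp X Y l f : Ω →ₘ[μ] 𝕜) ω)) := by
      simpa using (((RCLike.continuous_ofReal (K := 𝕜)).tendsto 0).comp b1 |>.mul_const
        ((y : Ω →ₘ[μ] 𝕜) ω)).const_sub ((mulOp X Y l f : Ω →ₘ[μ] 𝕜) ω)
    refine hlim'.congr fun m => ?_
    rw [b2, b3, b4, Finset.sum_congr rfl fun k _ => b5 k, ← Finset.sum_mul, ← mul_assoc]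
    push_cast
    rfl

theorem essNorm_mulOp [SigmaFinite μ] (hμ : IsNonatomic μ) (X Y : KotheSpace 𝕜 μ)
    (hY : Y.Fatou) (l : multipliers X Y) : essNorm (mulOp X Y l) = ‖mulOp X Y l‖ := by
  refine le_antisymm (csInf_le ⟨0, ?_⟩ ⟨0, isCompactOperator_zero, by rw [sub_zero]⟩)
    (le_csInf ⟨_, 0, isCompactOperator_zero, rfl⟩ ?_)
  · rintro r ⟨K, -, rfl⟩
    exact norm_nonneg _
  · rintro r ⟨K, hK, rfl⟩
    exact norm_mulOp_le_norm_sub hμ X Y hY l K hK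

theorem norm_mulOp (X Y : KotheSpace 𝕜 μ) (l : multipliers X Y) :
    ‖mulOp X Y l‖ = multiplierNorm X Y l := by
  have hle : ∀ r ∈ {r : ℝ | ∃ f : X, ‖f‖ ≤ 1 ∧ r = ‖mulLin X Y l f‖}, r ≤ ‖mulOp X Y l‖ := by
    rintro r ⟨f, hf, rfl⟩
    exact (mulOp X Y l).unit_le_opNorm f hf
  refine le_antisymm ?_ (csSup_le ⟨_, 0, by simp, rfl⟩ hle)
  refine ContinuousLinearMap.opNorm_le_of_unit_norm
    (Real.sSup_nonneg (by rintro r ⟨f, -, rfl⟩; exact norm_nonneg _)) fun f hf => ?_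
  exact le_csSup ⟨_, hle⟩ ⟨f, hf.le, rfl⟩

/-- The map `l ↦ M_l` is injective. -/
theorem eq_zero_of_mulOp_eq_zero [SigmaFinite μ] (X Y : KotheSpace 𝕜 μ) (l : multipliers X Y)
    (h : mulOp X Y l = 0) : l = 0 := by
  -- Indicators of the spanning sets lie in `X` and together cover `Ω`, so testing on them
  -- determines `l`.
  have key : ∀ n, ∀ᵐ ω ∂μ, ω ∈ spanningSets μ n → (l : Ω →ₘ[μ] 𝕜) ω = 0 := by
    intro n
    have hm := measurableSet_spanningSets μ n
    have hz : mulOp X Y l ⟨_, X.indicator_mem _ hm (measure_spanningSets_lt_top μ n)⟩ = 0 := by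
      rw [h]; rfl
    have h1 := coeFn_mulOp X Y l ⟨_, X.indicator_mem _ hm (measure_spanningSets_lt_top μ n)⟩
    rw [hz] at h1
    filter_upwards [h1, AEEqFun.coeFn_zero (μ := μ) (β := 𝕜),
      AEEqFun.coeFn_mk ((spanningSets μ n).indicator fun _ => (1 : 𝕜))
        (aestronglyMeasurable_const.indicator hm)] with ω a1 a2 a3 hω
    have a4 : ((0 : Y) : Ω →ₘ[μ] 𝕜) ω = 0 := a2
    rw [a4, a3, Set.indicator_of_mem hω, mul_one] at a1
    exact a1.symm
  refine Subtype.ext (AEEqFun.ext ?_)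
  filter_upwards [ae_all_iff.2 key, AEEqFun.coeFn_zero (μ := μ) (β := 𝕜)] with ω h1 h2
  rw [h1 _ (mem_spanningSetsIndex μ ω)]
  exact h2.symm

end EssentialNorm

end KotheSpace

end
theorem mainTheorem1 {𝕜 : Type*} [RCLike 𝕜] {Ω : Type*} [MeasurableSpace Ω] (μ : Measure Ω)
    [SigmaFinite μ] [μ.IsComplete] (hμ : IsNonatomic μ) (X Y : KotheSpace 𝕜 μ)
    (hX : X.Fatou) (hY : Y.Fatou) (hXY : X.OrderContinuous ∨ IsReflexiveSpace 𝕜 Y) :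
    (∀ l : KotheSpace.multipliers X Y,
      essNorm (KotheSpace.mulOp X Y l) = ‖KotheSpace.mulOp X Y l‖ ∧
      ‖KotheSpace.mulOp X Y l‖ = KotheSpace.multiplierNorm X Y l) ∧
    ∀ l : KotheSpace.multipliers X Y, IsCompactOperator (KotheSpace.mulOp X Y l) → l = 0 := by
  refine ⟨fun l => ⟨KotheSpace.essNorm_mulOp hμ X Y hY l, KotheSpace.norm_mulOp X Y l⟩,
    fun l hl => KotheSpace.eq_zero_of_mulOp_eq_zero X Y l ?_⟩
  -- The compact perturbation is taken to be `M_l` itself.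
  have h := KotheSpace.norm_mulOp_le_norm_sub hμ X Y hY l _ hl
  rw [sub_self, norm_zero] at h
  exact norm_le_zero_iff.1 h
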